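/- Notation. On $L^2(\mathbb R)$ let $\langle f,g\rangle=\int f\,\overline g$, and for $x,\omega\in\mathbb R$ let $(M_\omega T_x f)(t)=e^{2\pi i\omega t}f(t-x)$. The Feichtinger algebra $S_0$ is the set of $f\in L^2(\mathbb R)$ with $\iint|\langle f,M_\omega T_x\psi\rangle|\,dx\,d\omega<\infty$, where $\psi(t)=e^{-\pi t^2}$. For $a,b>0$ the Gabor system $\mathcal G(s,a,b)=\{M_{bl}T_{ak}s\}_{k,l\in\mathbb Z}$ is a Riesz sequence if there are $A>0$ and $B<\infty$ such that for every $c\in\ell^2(\mathbb Z^2)$ the series $\sum_{k,l}c_{k,l}M_{bl}T_{ak}s$ converges unconditionally in $L^2(\mathbb R)$ and $A\|c\|^2\le\big\|\sum_{k,l}c_{k,l}M_{bl}T_{ak}s\big\|^2\le B\|c\|^2$. Proposition 6.1. Let $a,b>0$ with $ab=q/p$, where $p,q$ are relatively prime positive integers, let $s,v\in S_0$, and suppose that $\mathcal G(s,a,b)$ and $\mathcal G(v,a,b)$ are Riesz sequences, with closed linear spans $\mathcal S$ and $\mathcal V$. Put $r_{sv}[k,l]=\langle v,M_{bl}T_{ak}s\rangle$.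 Then: 1. $r_{sv}\in\ell^1(\mathbb Z^2)$, so that the $p\times p$ matrix-valued function with entries $$\boldsymbol\Phi^{sv}_{m,n}(\omega,x)=\sum_{k,l\in\mathbb Z}r_{sv}[n-m+pk,l]\,e^{-2\pi i ablm}e^{-2\pi i(blx+ak\omega)},\qquad m,n=0,\dots,p-1,$$ is defined by absolutely convergent series for every $(\omega,x)\in\mathbb R^2$. 2. With the synthesis operator $Vc=\sum_{k,l}c_{k,l}M_{bl}T_{ak}v$ and the analysis operator $S^*f=\{\langle f,M_{bl}T_{ak}s\rangle\}_{k,l}$, the operator $S^*V$ is twisted convolution by $r_{sv}$: for all $c\in\ell^2(\mathbb Z^2)$ and $k,l\in\mathbb Z$, $$(S^*Vc)[k,l]=\sum_{m,n\in\mathbb Z}r_{sv}[m,n]\,c_{k-m,l-n}\,e^{-2\pi i ab(k-m)n}.$$ 3. $\mathcal S^\perp\oplus\mathcal V=L^2(\mathbb R)$ (that is, $\mathcal S^\perp\cap\mathcal V=\{0\}$ and $\mathcal S^\perp+\mathcal V=L^2(\mathbb R)$) if and only if $\boldsymbol\Phi^{sv}(\omega,x)$ is invertible for all $(\omega,x)\in[0,1/a)\times[0,1/b)$;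 and this is equivalent to $\det\boldsymbol\Phi^{sv}(\omega,x)\ne0$ for all $(\omega,x)\in\mathbb R^2$. -/

import Mathlib

open MeasureTheory
open scoped Real ENNReal

noncomputable section

namespace Gabor

/-- The Hilbert space of square integrable complex functions on the real line. Mathlib's inner
product is conjugate-linear in its first argument, so that the integral of `f` times the conjugate
of `g` is `inner ℂ g f`. -/
abbrev L2 : Type := Lp ℂ 2 (volume : Measure ℝ)

/-- The Hilbert space of square summable complex sequences indexed by pairs of integers. -/
abbrev ell2 : Type := lp (fun _ : ℤ × ℤ => ℂ) 2

theorem memLp_tfShift (x ω : ℝ) (f : L2) :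
    MemLp (fun t : ℝ => Complex.exp (2 * π * Complex.I * ω * t) * f (t - x)) 2 volume := by
  have h1 : MemLp (fun t : ℝ => f (t - x)) 2 volume :=
    (Lp.memLp f).comp_measurePreserving (measurePreserving_sub_right volume x)
  have hc : Continuous (fun t : ℝ => Complex.exp (2 * π * Complex.I * ω * t)) := by fun_prop
  refine h1.of_le (hc.aestronglyMeasurable.mul h1.1) (Filter.Eventually.of_forall fun t => ?_)
  have h2 : (2 * π * Complex.I * ω * t : ℂ) = ((2 * π * ω * t : ℝ) : ℂ) * Complex.I := by
    push_cast; ring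
  rw [norm_mul, h2, Complex.norm_exp_ofReal_mul_I, one_mul]

/-- The time-frequency shift `M_ω T_x`, that is `(M_ω T_x f)(t) = exp (2 π i ω t) f (t - x)`. -/
def tfShift (x ω : ℝ) (f : L2) : L2 := (memLp_tfShift x ω f).toLp _

theorem memLp_gaussian :
    MemLp (fun t : ℝ => (Real.exp (-π * t ^ 2) : ℂ)) 2 volume := by
  have hc : Continuous (fun t : ℝ => (Real.exp (-π * t ^ 2) : ℂ)) := by fun_prop
  rw [memLp_two_iff_integrable_sq_norm hc.aestronglyMeasurable]
  refine (integrable_exp_neg_mul_sq (b := 2 * π) (by positivity)).congr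
    (Filter.Eventually.of_forall fun t => ?_)
  simp only [Complex.norm_real, Real.norm_eq_abs, Real.abs_exp]
  rw [← Real.exp_nat_mul]
  congr 1
  push_cast
  ring

/-- The Gaussian window `t ↦ exp (-π t ^ 2)`. -/
def gaussian : L2 := memLp_gaussian.toLp _

/-- Membership in the Feichtinger algebra: the short-time Fourier transform
`(x, ω) ↦ ⟨f, M_ω T_x ψ⟩` of `f` with respect to the Gaussian window `ψ` is integrable on the
time-frequency plane. -/
def MemFeichtinger (f : L2) : Prop :=
  Integrable (fun z : ℝ × ℝ => inner ℂ (tfShift z.1 z.2 gaussian) f) volume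

/-- The Gabor system generated by `s`: the family `M_{bl} T_{ak} s`, indexed by `(k, l)`. -/
def gaborSystem (s : L2) (a b : ℝ) (k : ℤ × ℤ) : L2 := tfShift (a * k.1) (b * k.2) s

/-- The synthesis operator `c ↦ ∑ c_{k,l} M_{bl} T_{ak} s`. -/
def synthesis (s : L2) (a b : ℝ) (c : ell2) : L2 := ∑' k : ℤ × ℤ, c k • gaborSystem s a b k

/-- The analysis operator, sending `f` to the sequence `⟨f, M_{bl} T_{ak} s⟩`. -/
def analysis (s : L2) (a b : ℝ) (f : L2) (k : ℤ × ℤ) : ℂ := inner ℂ (gaborSystem s a b k) f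

/-- The Gabor system generated by `s` is a Riesz sequence, i.e. a Riesz basis for its closed linear
span: the synthesis series converge for all square summable coefficients, with two-sided bounds. -/
def IsRieszSequence (s : L2) (a b : ℝ) : Prop :=
  ∃ A B : ℝ, 0 < A ∧ ∀ c : ell2,
    Summable (fun k : ℤ × ℤ => c k • gaborSystem s a b k) ∧
    A * ‖c‖ ^ 2 ≤ ‖synthesis s a b c‖ ^ 2 ∧ ‖synthesis s a b c‖ ^ 2 ≤ B * ‖c‖ ^ 2

/-- The space spanned by the Gabor system: its closed linear span. -/
def gaborSpace (s : L2) (a b : ℝ) : Submodule ℂ L2 :=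
  (Submodule.span ℂ (Set.range (gaborSystem s a b))).topologicalClosure

/-- The cross-correlation sequence `r_{sv}[k, l] = ⟨v, M_{bl} T_{ak} s⟩`. -/
def crossCorr (s v : L2) (a b : ℝ) (k : ℤ × ℤ) : ℂ := inner ℂ (gaborSystem s a b k) v

/-- Twisted convolution with parameter `θ`:
`(d ♮ c)[k, l] = ∑ d_{m,n} c_{k-m,l-n} exp (-2 π i θ (k - m) n)`. -/
def twistedConv (θ : ℝ) (d c : ℤ × ℤ → ℂ) (k : ℤ × ℤ) : ℂ :=
  ∑' m : ℤ × ℤ, d m * c (k - m) * Complex.exp (-2 * π * Complex.I * θ * (k.1 - m.1) * m.2)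

/-- The matrix-valued function of a sequence `h`, with entries
`Φ_{m,n}(ω, x) = ∑ h[n - m + p k, l] exp (-2 π i a b l m) exp (-2 π i (b l x + a k ω))`. -/
def Phi (p : ℕ) (a b : ℝ) (h : ℤ × ℤ → ℂ) (ω x : ℝ) : Matrix (Fin p) (Fin p) ℂ :=
  Matrix.of fun m n => ∑' k : ℤ × ℤ,
    h ((n : ℤ) - (m : ℤ) + p * k.1, k.2) *
      Complex.exp (-2 * π * Complex.I * a * b * k.2 * (m : ℕ)) *
      Complex.exp (-2 * π * Complex.I * (b * k.2 * x + a * k.1 * ω))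

end Gabor

end

noncomputable section

/-! ### Plancherel's theorem through the Fourier integral -/

namespace Gabor

open FourierTransform SchwartzMap

/-! Write `S`, `V` for the synthesis operators. The Riesz bounds make both bounded and bounded
below, so their ranges are the closed spans, the orthogonal complement of the first span is `ker
S*`, and `S*` is onto. Hence the oblique decomposition says exactly that every `S* f` equals `S* V
c` for one and only one `c`, i.e. that `S* V` is bijective on `ℓ²`
(`isCompl_iff_bijective_crossOp`).

The matrix of `S* V` is `r[k - j]` times the phase `exp (-2πi ab j₁ (k₂ - j₂))`. Since `ab p = q` is
an integer, this phase sees `j₁` only modulo `p`. Splitting first indices into residue and quotient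
modulo `p` and taking Fourier series turns `ℓ²(ℤ²)` into `p`-tuples of `L²` functions on the torus,
and `S* V` into multiplication by a `p × p` matrix function (`blockEquiv_comp`), which is the
transpose of `Phi` after a change of variables. Its entries are continuous because `r` is summable.
On a compact space such a multiplication is bijective iff the determinant vanishes nowhere: if it
does not vanish, the inverse matrix is again continuous; at a zero, a kernel vector times the
indicator of a small neighbourhood contradicts boundedness of the inverse.

Summability of `r` comes from Moyal's identity: each `r[k, l]` is bounded by an integral of `|stft
v|` against a lattice translate of `|stft s|`. As `stft v` is integrable, it suffices to bound the
lattice sums of `|stft s|` uniformly; the same argument reduces this to lattice sums for the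
Gaussian, whose transform is explicit. -/

/-- Fubini moves the transform across the pairing. Testing against Schwartz functions links the
Fourier integral to the distributional description of the `L²` transform. -/
theorem integral_fourier_smul_schwartz {f : ℝ → ℂ} (hf : Integrable f) (g : 𝓢(ℝ, ℂ)) :
    ∫ x, (𝓕 g) x • f x = ∫ x, g x • (𝓕 f) x := by
  have h := VectorFourier.integral_fourierIntegral_smul_eq_flip (e := Real.fourierChar)
    (L := innerₗ ℝ) (μ := volume) (ν := volume) Real.continuous_fourierChar continuous_inner
    g.integrable hf
  simp only [flip_innerₗ] at h
  exact h

/-- On integrable square integrable functions, the Fourier transform of `L²` is the one given by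
the Fourier integral. -/
theorem coeFn_fourier_toLp {f : ℝ → ℂ} (hf : Integrable f) (hf2 : MemLp f 2) :
    (𝓕 (hf2.toLp f) : Lp ℂ 2 (volume : Measure ℝ)) =ᵐ[volume] 𝓕 f := by
  have hcont : Continuous (𝓕 f) :=
    VectorFourier.fourierIntegral_continuous Real.continuous_fourierChar continuous_inner hf
  -- Equality a.e. follows from equal pairings with real test functions; complexified, such a
  -- function is a Schwartz function, to which the distributional identity applies.
  refine ae_eq_of_integral_contDiff_smul_eq
    ((Lp.memLp _).locallyIntegrable (by norm_num)) hcont.locallyIntegrable ?_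
  intro g hg hgs
  have hgs' : HasCompactSupport (fun x => (g x : ℂ)) := hgs.comp_left Complex.ofReal_zero
  have hg' : ContDiff ℝ ((⊤ : ℕ∞) : WithTop ℕ∞) (fun x => (g x : ℂ)) := Complex.ofRealCLM.contDiff.comp hg
  set G : 𝓢(ℝ, ℂ) := hgs'.toSchwartzMap hg' with hG
  have hGx : ∀ x, G x = g x := fun x => by simp [hG]
  have h1 := congrArg (fun T => T G)
    (Lp.fourier_toTemperedDistribution_eq (hf2.toLp f))
  simp only [TemperedDistribution.fourier_apply, Lp.toTemperedDistribution_apply] at h1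
  have h2 : ∫ x, (𝓕 G) x • (hf2.toLp f) x = ∫ x, (𝓕 G) x • f x :=
    integral_congr_ae (by filter_upwards [hf2.coeFn_toLp] with x hx; rw [hx])
  rw [h2, integral_fourier_smul_schwartz hf] at h1
  simp only [hGx] at h1
  simpa [Complex.real_smul] using h1.symm

/-- Plancherel's theorem for integrable square integrable functions. -/
theorem integral_conj_fourier_mul_fourier {f g : ℝ → ℂ} (hf : Integrable f) (hf2 : MemLp f 2)
    (hg : Integrable g) (hg2 : MemLp g 2) :
    ∫ ω, (starRingEnd ℂ) (𝓕 g ω) * 𝓕 f ω = ∫ t, (starRingEnd ℂ) (g t) * f t := by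
  have h := Lp.inner_fourier_eq (hg2.toLp g) (hf2.toLp f)
  rw [L2.inner_def, L2.inner_def] at h
  have h1 : ∫ ω, inner ℂ ((𝓕 (hg2.toLp g) : Lp ℂ 2 (volume : Measure ℝ)) ω)
      ((𝓕 (hf2.toLp f) : Lp ℂ 2 (volume : Measure ℝ)) ω)
      = ∫ ω, (starRingEnd ℂ) (𝓕 g ω) * 𝓕 f ω := by
    refine integral_congr_ae ?_
    filter_upwards [coeFn_fourier_toLp hf hf2, coeFn_fourier_toLp hg hg2] with x hx hy
    rw [hx, hy, RCLike.inner_apply, mul_comm]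
  rw [← h1, h]
  refine integral_congr_ae ?_
  filter_upwards [hf2.coeFn_toLp, hg2.coeFn_toLp] with x hx hy
  rw [hx, hy, RCLike.inner_apply, mul_comm]

end Gabor

/-! ### Time-frequency shifts, the short-time Fourier transform and Moyal's identity -/

namespace Gabor

theorem coeFn_tfShift (x ω : ℝ) (f : L2) :
    tfShift x ω f =ᵐ[volume]
      fun t : ℝ => Complex.exp (2 * π * Complex.I * ω * t) * f (t - x) :=
  (memLp_tfShift x ω f).coeFn_toLp

/-- The phase is the price of commuting a translation past a modulation. -/
theorem tfShift_tfShift (x ω y η : ℝ) (f : L2) :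
    tfShift x ω (tfShift y η f) =
      Complex.exp (-2 * π * Complex.I * η * x) • tfShift (x + y) (ω + η) f := by
  apply Lp.ext
  have h1 := (measurePreserving_sub_right (volume : Measure ℝ) x).quasiMeasurePreserving.ae_eq_comp
    (coeFn_tfShift y η f)
  filter_upwards [coeFn_tfShift x ω (tfShift y η f), coeFn_tfShift (x + y) (ω + η) f, h1,
    Lp.coeFn_smul (Complex.exp (-2 * π * Complex.I * η * x)) (tfShift (x + y) (ω + η) f)]
    with t h2 h3 h4 h5
  simp only [Function.comp_apply] at h4
  rw [h2, h4, h5, Pi.smul_apply, h3, smul_eq_mul, ← mul_assoc, ← mul_assoc, ← Complex.exp_add,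
    ← Complex.exp_add, sub_sub]
  congr 2
  push_cast
  ring

theorem norm_exp_mul_I_real (r : ℝ) (z : ℂ) (hz : z = r * Complex.I) :
    ‖Complex.exp z‖ = 1 := by
  rw [hz, Complex.norm_exp_ofReal_mul_I]

theorem inner_tfShift_same (x ω : ℝ) (f g : L2) :
    inner ℂ (tfShift x ω f) (tfShift x ω g) = inner ℂ f g := by
  rw [L2.inner_def, L2.inner_def, ← integral_sub_right_eq_self (μ := volume)
    (fun t => inner ℂ (f t) (g t)) x]
  refine integral_congr_ae ?_
  filter_upwards [coeFn_tfShift x ω f, coeFn_tfShift x ω g] with t h1 h2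
  have h3 := norm_exp_mul_I_real (2 * π * ω * t) (2 * π * Complex.I * ω * t) (by push_cast; ring)
  rw [h1, h2, RCLike.inner_apply, RCLike.inner_apply, map_mul, mul_mul_mul_comm,
    Complex.mul_conj, Complex.normSq_eq_norm_sq, h3]
  simp

/-- Inner products of time-frequency shifts depend, up to a phase factor, only on the difference of
the shifts. -/
theorem inner_tfShift_tfShift (x ω y η : ℝ) (f g : L2) :
    inner ℂ (tfShift x ω f) (tfShift y η g) =
      Complex.exp (-2 * π * Complex.I * (ω - η) * y) *
        inner ℂ (tfShift (x - y) (ω - η) f) g := by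
  have h := tfShift_tfShift y η (x - y) (ω - η) f
  rw [add_sub_cancel, add_sub_cancel] at h
  rw [← inner_tfShift_same y η (tfShift (x - y) (ω - η) f) g, h, inner_smul_left, ← mul_assoc,
    ← Complex.exp_conj, ← Complex.exp_add]
  have : (-2 * π * Complex.I * (ω - η) * y : ℂ) +
      (starRingEnd ℂ) (-2 * π * Complex.I * ((ω - η : ℝ) : ℂ) * y) = 0 := by
    simp only [map_mul, map_neg, Complex.conj_I, Complex.conj_ofReal, map_ofNat]
    push_cast
    ring
  rw [this, Complex.exp_zero, one_mul]

theorem norm_inner_tfShift_tfShift (x ω y η : ℝ) (f g : L2) :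
    ‖inner ℂ (tfShift x ω f) (tfShift y η g)‖ =
      ‖inner ℂ (tfShift (x - y) (ω - η) f) g‖ := by
  rw [inner_tfShift_tfShift, norm_mul, norm_exp_mul_I_real (-2 * π * (ω - η) * y) _
    (by push_cast; ring), one_mul]

/-- The short-time Fourier transform with the Gaussian window. -/
def stft (f : L2) (z : ℝ × ℝ) : ℂ := inner ℂ (tfShift z.1 z.2 gaussian) f

theorem norm_stft_tfShift (y η : ℝ) (f : L2) (z : ℝ × ℝ) :
    ‖stft (tfShift y η f) z‖ = ‖stft f (z - (y, η))‖ :=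
  norm_inner_tfShift_tfShift _ _ _ _ _ _

theorem norm_stft_le (f : L2) (z : ℝ × ℝ) : ‖stft f z‖ ≤ ‖gaussian‖ * ‖f‖ := by
  have h : ‖tfShift z.1 z.2 gaussian‖ = ‖gaussian‖ := by
    rw [← sq_eq_sq₀ (norm_nonneg _) (norm_nonneg _), ← inner_self_eq_norm_sq (𝕜 := ℂ),
      inner_tfShift_same, inner_self_eq_norm_sq (𝕜 := ℂ)]
  exact (norm_inner_le_norm _ _).trans_eq (by rw [h])

/-- The Gaussian as a function. -/
def gaussFun (t : ℝ) : ℝ := Real.exp (-π * t ^ 2)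

theorem gaussFun_pos (t : ℝ) : 0 < gaussFun t := Real.exp_pos _

theorem gaussFun_le_one (t : ℝ) : gaussFun t ≤ 1 :=
  Real.exp_le_one_iff.2 (by have := mul_nonneg Real.pi_pos.le (sq_nonneg t); linarith)

theorem memLp_gaussFun_sub (x : ℝ) : MemLp (fun t => (gaussFun (t - x) : ℂ)) 2 volume :=
  memLp_gaussian.comp_measurePreserving (measurePreserving_sub_right volume x)

theorem integrable_windowed (x : ℝ) (f : L2) :
    Integrable (fun t => (gaussFun (t - x) : ℂ) * f t) :=
  (memLp_gaussFun_sub x).integrable_mul (Lp.memLp f)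

theorem memLp_windowed (x : ℝ) (f : L2) :
    MemLp (fun t => (gaussFun (t - x) : ℂ) * f t) 2 volume := by
  refine (Lp.memLp f).of_le (integrable_windowed x f).1 (Filter.Eventually.of_forall fun t => ?_)
  rw [norm_mul, Complex.norm_real, Real.norm_of_nonneg (gaussFun_pos _).le]
  exact mul_le_of_le_one_left (norm_nonneg _) (gaussFun_le_one _)

-- For fixed `x` this reduces the dependence on `ω` to an ordinary Fourier transform of an
-- integrable, square integrable function, so Plancherel applies in `ω`.
open FourierTransform in
theorem stft_eq_fourier (f : L2) (x ω : ℝ) :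
    stft f (x, ω) = 𝓕 (fun t => (gaussFun (t - x) : ℂ) * f t) ω := by
  rw [stft, L2.inner_def, Real.fourier_real_eq_integral_exp_smul]
  refine integral_congr_ae ?_
  have h1 := (measurePreserving_sub_right (volume : Measure ℝ) x).quasiMeasurePreserving.ae_eq_comp
    memLp_gaussian.coeFn_toLp
  filter_upwards [coeFn_tfShift x ω gaussian, h1] with t h2 h3
  simp only [Function.comp_apply] at h3
  rw [h2, RCLike.inner_apply, map_mul, ← Complex.exp_conj]
  change _ * (_ * (starRingEnd ℂ) ((memLp_gaussian.toLp _ : L2) (t - x))) = _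
  rw [h3, Complex.conj_ofReal, smul_eq_mul]
  simp only [map_mul, Complex.conj_I, Complex.conj_ofReal, map_ofNat, gaussFun]
  rw [mul_comm (f t), mul_assoc]
  congr 2
  push_cast
  ring

theorem stronglyMeasurable_stft (f : L2) : StronglyMeasurable (stft f) := by
  have h : stft f = fun z : ℝ × ℝ => ∫ t : ℝ,
      Complex.exp (((-2 * π * t * z.2 : ℝ) : ℂ) * Complex.I) •
        ((gaussFun (t - z.1) : ℂ) * f t) := by
    funext z
    rw [← Real.fourier_real_eq_integral_exp_smul, ← stft_eq_fourier]
  rw [h]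
  refine StronglyMeasurable.integral_prod_right
    (f := fun (z : ℝ × ℝ) (t : ℝ) => Complex.exp (((-2 * π * t * z.2 : ℝ) : ℂ) * Complex.I) •
        ((gaussFun (t - z.1) : ℂ) * f t)) ?_
  have h1 : Continuous (fun w : (ℝ × ℝ) × ℝ =>
      Complex.exp (((-2 * π * w.2 * w.1.2 : ℝ) : ℂ) * Complex.I)) := by fun_prop
  have h2 : Continuous (fun w : (ℝ × ℝ) × ℝ => (gaussFun (w.2 - w.1.1) : ℂ)) := by
    unfold gaussFun; fun_prop
  exact h1.stronglyMeasurable.smul (h2.stronglyMeasurable.mul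
    ((Lp.stronglyMeasurable f).comp_measurable measurable_snd))

theorem integrable_gaussFun_sq : Integrable (fun t => gaussFun t ^ 2) := by
  have h := (memLp_two_iff_integrable_sq_norm memLp_gaussian.1).1 memLp_gaussian
  refine h.congr (Filter.Eventually.of_forall fun t => ?_)
  simp only [Complex.norm_real, Real.norm_eq_abs, sq_abs]
  rfl

/-- The squared norm of the Gaussian window. -/
def gaussSq : ℝ := ∫ t, gaussFun t ^ 2

theorem gaussSq_pos : 0 < gaussSq := by
  have hs : Function.support (fun t => gaussFun t ^ 2) = Set.univ :=
    Set.eq_univ_of_forall fun t => (pow_pos (gaussFun_pos t) 2).ne'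
  rw [gaussSq, integral_pos_iff_support_of_nonneg (fun t => sq_nonneg _) integrable_gaussFun_sq, hs]
  simp

/-- Moyal's identity: the orthogonality relation for the short-time Fourier transform. -/
theorem integral_conj_stft_mul_stft (f g : L2) (hf : Integrable (stft f)) :
    ∫ z, (starRingEnd ℂ) (stft g z) * stft f z = gaussSq * inner ℂ g f := by
  have hint : Integrable (fun z => (starRingEnd ℂ) (stft g z) * stft f z) := by
    refine Integrable.bdd_mul (c := ‖gaussian‖ * ‖g‖) hf ?_ ?_
    · exact (Complex.continuous_conj.comp_stronglyMeasurable
        (stronglyMeasurable_stft g)).aestronglyMeasurable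
    · refine Filter.Eventually.of_forall fun z => ?_
      rw [RCLike.norm_conj]
      exact norm_stft_le g z
  have hfg : Integrable (fun t => inner ℂ (g t) (f t)) := L2.integrable_inner g f
  rw [Measure.volume_eq_prod, integral_prod _ hint]
  -- Plancherel in `ω`; evenness of the Gaussian then exhibits the result as a convolution evaluated
  -- at `x`.
  have h1 : ∀ x : ℝ, ∫ ω, (starRingEnd ℂ) (stft g (x, ω)) * stft f (x, ω)
      = ∫ t, inner ℂ (g t) (f t) * ((gaussFun (x - t) ^ 2 : ℝ) : ℂ) := by
    intro x
    simp only [stft_eq_fourier]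
    rw [integral_conj_fourier_mul_fourier (integrable_windowed x f) (memLp_windowed x f)
      (integrable_windowed x g) (memLp_windowed x g)]
    congr 1
    funext t
    have : gaussFun (x - t) = gaussFun (t - x) := by
      unfold gaussFun; congr 2; ring
    rw [this, RCLike.inner_apply, map_mul, Complex.conj_ofReal]
    push_cast
    ring
  simp only [h1]
  -- The integral of a convolution is the product of the integrals.
  have h2 := integral_convolution (μ := volume) (ν := volume) (ContinuousLinearMap.mul ℝ ℂ) hfg
    (integrable_gaussFun_sq.ofReal (𝕜 := ℂ))
  simp only [convolution, ContinuousLinearMap.mul_apply'] at h2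
  refine h2.trans ?_
  rw [L2.inner_def, mul_comm, gaussSq]
  congr 1
  exact integral_ofReal

end Gabor

/-! ### Summability of the cross-correlation -/

namespace Gabor

/-- Inner products with the members of a family whose short-time Fourier transforms are uniformly
absolutely summable are absolutely summable. -/
theorem sum_norm_inner_le {ι : Type*} (f : L2) (hf : Integrable (stft f)) (F : Finset ι)
    (g : ι → L2) (K : ℝ) (hK : ∀ z, ∑ i ∈ F, ‖stft (g i) z‖ ≤ K) :
    ∑ i ∈ F, ‖inner ℂ (g i) f‖ ≤ K / gaussSq * ∫ z, ‖stft f z‖ := by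
  have hint : ∀ i, Integrable (fun z => ‖stft (g i) z‖ * ‖stft f z‖) := fun i => by
    refine Integrable.bdd_mul (c := ‖gaussian‖ * ‖g i‖) hf.norm
      (stronglyMeasurable_stft (g i)).norm.aestronglyMeasurable ?_
    exact Filter.Eventually.of_forall fun z => by
      rw [norm_norm]; exact norm_stft_le _ z
  have h1 : ∀ i, gaussSq * ‖inner ℂ (g i) f‖ ≤ ∫ z, ‖stft (g i) z‖ * ‖stft f z‖ := by
    intro i
    have h := congrArg norm (integral_conj_stft_mul_stft f (g i) hf)
    rw [norm_mul, Complex.norm_real, Real.norm_of_nonneg gaussSq_pos.le] at h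
    rw [← h]
    refine (norm_integral_le_integral_norm _).trans_eq ?_
    simp only [norm_mul, RCLike.norm_conj]
  rw [div_mul_eq_mul_div, le_div_iff₀ gaussSq_pos, mul_comm, Finset.mul_sum,
    ← integral_const_mul]
  calc ∑ i ∈ F, gaussSq * ‖inner ℂ (g i) f‖
      ≤ ∑ i ∈ F, ∫ z, ‖stft (g i) z‖ * ‖stft f z‖ := Finset.sum_le_sum fun i _ => h1 i
    _ = ∫ z, ∑ i ∈ F, ‖stft (g i) z‖ * ‖stft f z‖ :=
        (integral_finsetSum _ fun i _ => hint i).symm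
    _ ≤ ∫ z, K * ‖stft f z‖ := by
        refine integral_mono (integrable_finsetSum _ fun i _ => hint i) (hf.norm.const_mul K) ?_
        intro z
        simp only [← Finset.sum_mul]
        exact mul_le_mul_of_nonneg_right (hK z) (norm_nonneg _)

/-- The integral is Gaussian with a complex linear term, hence explicit: the exponent has real part
`-(π/2)(x² + ω²)`, and its imaginary part `-πxω` drops out of the modulus. -/
theorem norm_stft_gaussian_le : ∃ C : ℝ, 0 ≤ C ∧ ∀ z : ℝ × ℝ,
    ‖stft gaussian z‖ ≤ C * (Real.exp (-(π / 2) * z.1 ^ 2) * Real.exp (-(π / 2) * z.2 ^ 2)) := by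
  refine ⟨‖((π / -(-2 * π) : ℂ) ^ (1 / 2 : ℂ))‖, norm_nonneg _, ?_⟩
  rintro ⟨x, ω⟩
  have hb : (-2 * π : ℂ).re < 0 := by simp [Real.pi_pos]
  have h := integral_cexp_quadratic hb (2 * π * x - 2 * π * ω * Complex.I) (-π * x ^ 2)
  have h1 : stft gaussian (x, ω) = ∫ t : ℝ, Complex.exp (-2 * π * t ^ 2 +
      (2 * π * x - 2 * π * ω * Complex.I) * t + (-π * x ^ 2)) := by
    rw [stft_eq_fourier, Real.fourier_real_eq_integral_exp_smul]
    refine integral_congr_ae ?_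
    have hg : gaussian =ᵐ[volume] fun t => (gaussFun t : ℂ) := memLp_gaussian.coeFn_toLp
    filter_upwards [hg] with t ht
    rw [ht, gaussFun, gaussFun, Complex.ofReal_exp, Complex.ofReal_exp, smul_eq_mul,
      ← Complex.exp_add, ← Complex.exp_add]
    congr 1
    push_cast
    ring
  rw [h1, h, norm_mul, Complex.norm_exp, ← Real.exp_add]
  refine mul_le_mul_of_nonneg_left (Real.exp_le_exp.2 (le_of_eq ?_)) (norm_nonneg _)
  have h2 : (-π * x ^ 2 - (2 * π * x - 2 * π * ω * Complex.I) ^ 2 / (4 * (-2 * π)) : ℂ) =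
      ((-(π / 2) * x ^ 2 + -(π / 2) * ω ^ 2 : ℝ) : ℂ) + ((-π * x * ω : ℝ) : ℂ) * Complex.I := by
    have hpi : (π : ℂ) ≠ 0 := Complex.ofReal_ne_zero.2 Real.pi_ne_zero
    push_cast
    field_simp
    ring_nf
    simp only [Complex.I_sq]
    ring
  rw [h2, Complex.add_re, Complex.ofReal_re, Complex.re_ofReal_mul, Complex.I_re, mul_zero,
    add_zero]

/-- These are the moduli of the Jacobi theta terms at `z = 0`, `τ = i c / π`. -/
theorem summable_exp_neg_mul_int_sq {c : ℝ} (hc : 0 < c) :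
    Summable (fun k : ℤ => Real.exp (-c * (k : ℝ) ^ 2)) := by
  have h := ((summable_jacobiTheta₂_term_iff 0 ((c / π : ℝ) * Complex.I)).2
    (by simpa using div_pos hc Real.pi_pos)).norm
  refine h.congr fun k => ?_
  rw [jacobiTheta₂_term, Complex.norm_exp]
  congr 1
  have hpi : (π : ℂ) ≠ 0 := Complex.ofReal_ne_zero.2 Real.pi_ne_zero
  have : (2 * π * Complex.I * k * 0 + π * Complex.I * k ^ 2 * ((c / π : ℝ) * Complex.I) : ℂ) =
      ((-c * (k : ℝ) ^ 2 : ℝ) : ℂ) := by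
    push_cast
    field_simp
    ring_nf
    simp only [Complex.I_sq]
    ring
  rw [this, Complex.ofReal_re]

/-- Recentring at the lattice point `a m` nearest to `u` compares the sum with a fixed one, at the
cost of halving the decay rate; hence uniformity in `u`. -/
theorem sum_exp_lattice_le {a : ℝ} (ha : a ≠ 0) : ∃ K : ℝ, 0 ≤ K ∧ ∀ (u : ℝ) (F : Finset ℤ),
    ∑ k ∈ F, Real.exp (-(π / 2) * (u - a * k) ^ 2) ≤ K := by
  have hc : 0 < π * a ^ 2 / 4 := by positivity
  have hs := summable_exp_neg_mul_int_sq hc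
  refine ⟨Real.exp (π * a ^ 2 / 8) * ∑' k : ℤ, Real.exp (-(π * a ^ 2 / 4) * (k : ℝ) ^ 2),
    mul_nonneg (Real.exp_pos _).le (tsum_nonneg fun _ => (Real.exp_pos _).le), ?_⟩
  intro u F
  set m : ℤ := round (u / a) with hm
  have hs' : Summable fun k : ℤ =>
      Real.exp (-(π * a ^ 2 / 4) * (((Equiv.subRight m) k : ℤ) : ℝ) ^ 2) :=
    (Equiv.subRight m).summable_iff.2 hs
  rw [← (Equiv.subRight m).tsum_eq fun k : ℤ => Real.exp (-(π * a ^ 2 / 4) * (k : ℝ) ^ 2)]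
  calc ∑ k ∈ F, Real.exp (-(π / 2) * (u - a * k) ^ 2)
      ≤ ∑ k ∈ F, Real.exp (π * a ^ 2 / 8) *
          Real.exp (-(π * a ^ 2 / 4) * (((Equiv.subRight m) k : ℤ) : ℝ) ^ 2) := by
        refine Finset.sum_le_sum fun k _ => ?_
        rw [← Real.exp_add]
        refine Real.exp_le_exp.2 ?_
        have h1 : |u / a - m| ≤ 1 / 2 := abs_sub_round _
        have h2 : (u / a - m) ^ 2 ≤ 1 / 4 := by
          have := sq_le_sq' (abs_le.1 h1).1 (abs_le.1 h1).2
          linarith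
        have h3 : (u - a * m) ^ 2 ≤ a ^ 2 / 4 := by
          have h4 : u - a * m = a * (u / a - m) := by field_simp
          rw [h4, mul_pow]
          nlinarith [sq_nonneg a]
        simp only [Equiv.subRight_apply, Int.cast_sub]
        -- Multiplied by `π/4` and combined with `h3`, this produces the rate `π a²/4` and the
        -- constant `exp (π a²/8)`.
        have h5 : (a * (k - m)) ^ 2 ≤ 2 * (u - a * k) ^ 2 + 2 * (u - a * m) ^ 2 := by
          nlinarith [sq_nonneg ((u - a * k) + (u - a * m))]
        have h6 : 0 ≤ π / 4 * (2 * (u - a * k) ^ 2 + a ^ 2 / 2 - (a * (k - m)) ^ 2) :=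
          mul_nonneg (by positivity) (by linarith)
        nlinarith [h6]
    _ = Real.exp (π * a ^ 2 / 8) * ∑ k ∈ F,
          Real.exp (-(π * a ^ 2 / 4) * (((Equiv.subRight m) k : ℤ) : ℝ) ^ 2) := by
        rw [Finset.mul_sum]
    _ ≤ _ := mul_le_mul_of_nonneg_left
        (hs'.sum_le_tsum F fun _ _ => (Real.exp_pos _).le) (Real.exp_pos _).le

theorem sum_norm_stft_gaussian_le {a b : ℝ} (ha : a ≠ 0) (hb : b ≠ 0) :
    ∃ K : ℝ, ∀ (z : ℝ × ℝ) (F : Finset (ℤ × ℤ)),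
      ∑ k ∈ F, ‖stft gaussian (z - (a * k.1, b * k.2))‖ ≤ K := by
  obtain ⟨C, hC, hbound⟩ := norm_stft_gaussian_le
  obtain ⟨A, hA, h1⟩ := sum_exp_lattice_le ha
  obtain ⟨B, hB, h2⟩ := sum_exp_lattice_le hb
  refine ⟨C * (A * B), fun z F => ?_⟩
  classical
  calc ∑ k ∈ F, ‖stft gaussian (z - (a * k.1, b * k.2))‖
      ≤ ∑ k ∈ F, C * (Real.exp (-(π / 2) * (z.1 - a * k.1) ^ 2) *
          Real.exp (-(π / 2) * (z.2 - b * k.2) ^ 2)) := Finset.sum_le_sum fun k _ => hbound _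
    -- Enlarging `F` to the product of its projections lets the sum factor.
    _ ≤ ∑ k ∈ F.image Prod.fst ×ˢ F.image Prod.snd,
          C * (Real.exp (-(π / 2) * (z.1 - a * k.1) ^ 2) *
          Real.exp (-(π / 2) * (z.2 - b * k.2) ^ 2)) :=
        Finset.sum_le_sum_of_subset_of_nonneg Finset.subset_product
          fun _ _ _ => by positivity
    _ = C * ((∑ k ∈ F.image Prod.fst, Real.exp (-(π / 2) * (z.1 - a * k) ^ 2)) *
          ∑ k ∈ F.image Prod.snd, Real.exp (-(π / 2) * (z.2 - b * k) ^ 2)) := by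
        rw [← Finset.mul_sum, Finset.sum_mul_sum, Finset.sum_product]
    _ ≤ C * (A * B) := mul_le_mul_of_nonneg_left
        (mul_le_mul (h1 _ _) (h2 _ _) (Finset.sum_nonneg fun _ _ => (Real.exp_pos _).le) hA) hC

/-- The short-time Fourier transform of a function in the Feichtinger algebra is uniformly
absolutely summable along the translates of a lattice. -/
theorem sum_norm_stft_le {a b : ℝ} (ha : a ≠ 0) (hb : b ≠ 0) (s : L2) (hs : MemFeichtinger s) :
    ∃ K : ℝ, ∀ (z : ℝ × ℝ) (F : Finset (ℤ × ℤ)),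
      ∑ k ∈ F, ‖stft s (z - (a * k.1, b * k.2))‖ ≤ K := by
  -- The values of `stft s` are inner products with Gaussians shifted by `z - (a k, b l)`; the minus
  -- sign is why the lattice is negated.
  obtain ⟨K, hK⟩ := sum_norm_stft_gaussian_le (neg_ne_zero.2 ha) (neg_ne_zero.2 hb)
  refine ⟨_, fun z F => sum_norm_inner_le s hs F
    (fun k => tfShift (z - (a * k.1, b * k.2)).1 (z - (a * k.1, b * k.2)).2 gaussian) K
    fun w => ?_⟩
  refine (Finset.sum_congr rfl fun k _ => ?_).trans_le (hK (w - z) F)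
  rw [norm_stft_tfShift]
  congr 2
  ext <;> simp <;> ring

/-- The cross-correlation sequence of two functions in the Feichtinger algebra is summable. -/
theorem summable_crossCorr {a b : ℝ} (ha : a ≠ 0) (hb : b ≠ 0) (s v : L2)
    (hs : MemFeichtinger s) (hv : MemFeichtinger v) : Summable (crossCorr s v a b) := by
  obtain ⟨K, hK⟩ := sum_norm_stft_le ha hb s hs
  refine Summable.of_norm (summable_of_sum_le (fun _ => norm_nonneg _)
    fun F => sum_norm_inner_le v hv F (gaborSystem s a b) K fun z => ?_)
  refine (Finset.sum_congr rfl fun k _ => ?_).trans_le (hK z F)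
  rw [gaborSystem, norm_stft_tfShift]

end Gabor

/-! ### Riesz sequences and the oblique decomposition -/

namespace Gabor

variable {s v : L2} {a b : ℝ}

namespace IsRieszSequence

theorem summable (hs : IsRieszSequence s a b) (c : ell2) :
    Summable fun k : ℤ × ℤ => c k • gaborSystem s a b k := by
  obtain ⟨A, B, -, h⟩ := hs
  exact (h c).1

/-- The synthesis operator of a Riesz sequence as a bounded operator. -/
def synthesisCLM (hs : IsRieszSequence s a b) : ell2 →L[ℂ] L2 :=
  LinearMap.mkContinuousOfExistsBound
    { toFun := synthesis s a b
      map_add' := fun c d => by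
        simp only [synthesis, lp.coeFn_add, Pi.add_apply, add_smul]
        exact (hs.summable c).tsum_add (hs.summable d)
      map_smul' := fun r c => by
        simp only [synthesis, lp.coeFn_smul, Pi.smul_apply, smul_assoc, RingHom.id_apply]
        exact (hs.summable c).tsum_const_smul r }
    (by
      obtain ⟨A, B, -, h⟩ := hs
      refine ⟨Real.sqrt (max B 0), fun c => ?_⟩
      rw [← abs_of_nonneg (norm_nonneg c), ← Real.sqrt_sq_eq_abs, ← Real.sqrt_mul (le_max_right _ _)]
      refine Real.le_sqrt_of_sq_le ((h c).2.2.trans ?_)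
      exact mul_le_mul_of_nonneg_right (le_max_left _ _) (sq_nonneg _))

@[simp]
theorem synthesisCLM_apply (hs : IsRieszSequence s a b) (c : ell2) :
    hs.synthesisCLM c = synthesis s a b c := rfl

theorem exists_bound_below (hs : IsRieszSequence s a b) :
    ∃ A : ℝ, 0 < A ∧ ∀ c, A * ‖c‖ ^ 2 ≤ ‖hs.synthesisCLM c‖ ^ 2 := by
  obtain ⟨A, B, hA, h⟩ := hs
  exact ⟨A, hA, fun c => (h c).2.1⟩

theorem hasSum (hs : IsRieszSequence s a b) (c : ell2) :
    HasSum (fun k : ℤ × ℤ => c k • gaborSystem s a b k) (hs.synthesisCLM c) :=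
  (hs.summable c).hasSum

theorem synthesisCLM_single (hs : IsRieszSequence s a b) (k : ℤ × ℤ) :
    hs.synthesisCLM (lp.single 2 k 1) = gaborSystem s a b k := by
  classical
  have h := hs.hasSum (lp.single 2 k 1)
  refine h.unique ?_
  convert! hasSum_ite_eq k (gaborSystem s a b k) using 2 with j
  rw [lp.single_apply, Pi.single_apply]
  split_ifs with hj
  · rw [hj, one_smul]
  · rw [zero_smul]

theorem antilipschitz (hs : IsRieszSequence s a b) :
    ∃ K, AntilipschitzWith K hs.synthesisCLM := by
  obtain ⟨A, hA, h⟩ := hs.exists_bound_below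
  refine ⟨((Real.sqrt A)⁻¹).toNNReal,
    ContinuousLinearMap.antilipschitz_of_bound _ fun c => ?_⟩
  rw [Real.coe_toNNReal _ (by positivity), ← div_eq_inv_mul, le_div_iff₀ (Real.sqrt_pos.2 hA),
    ← sq_le_sq₀ (by positivity) (norm_nonneg _), mul_pow, Real.sq_sqrt hA.le, mul_comm]
  exact h c

theorem isClosed_range (hs : IsRieszSequence s a b) :
    IsClosed (Set.range hs.synthesisCLM) := by
  obtain ⟨K, hK⟩ := hs.antilipschitz
  exact hK.isClosed_range hs.synthesisCLM.uniformContinuous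

theorem injective (hs : IsRieszSequence s a b) : Function.Injective hs.synthesisCLM := by
  obtain ⟨K, hK⟩ := hs.antilipschitz
  exact hK.injective

/-- The closed linear span of a Gabor Riesz sequence is the range of its synthesis operator. -/
theorem gaborSpace_eq_range (hs : IsRieszSequence s a b) :
    gaborSpace s a b = LinearMap.range (hs.synthesisCLM : ell2 →ₗ[ℂ] L2) := by
  apply le_antisymm
  · refine Submodule.topologicalClosure_minimal _ (Submodule.span_le.2 ?_) ?_
    · rintro _ ⟨k, rfl⟩
      exact ⟨lp.single 2 k 1, hs.synthesisCLM_single k⟩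
    · exact hs.isClosed_range
  · rintro _ ⟨c, rfl⟩
    refine mem_closure_of_tendsto (hs.hasSum c) (Filter.Eventually.of_forall fun F => ?_)
    exact Submodule.sum_mem _ fun k _ =>
      Submodule.smul_mem _ _ (Submodule.subset_span ⟨k, rfl⟩)

theorem mem_gaborSpace_orthogonal (hs : IsRieszSequence s a b) (f : L2) :
    f ∈ (gaborSpace s a b)ᗮ ↔ ContinuousLinearMap.adjoint hs.synthesisCLM f = 0 := by
  rw [hs.gaborSpace_eq_range, ContinuousLinearMap.orthogonal_range]
  rfl

theorem adjoint_apply (hs : IsRieszSequence s a b) (f : L2) (k : ℤ × ℤ) :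
    (ContinuousLinearMap.adjoint hs.synthesisCLM f : ell2) k = analysis s a b f k := by
  have h := ContinuousLinearMap.adjoint_inner_right hs.synthesisCLM (lp.single 2 k 1) f
  rw [lp.inner_single_left, hs.synthesisCLM_single] at h
  simpa [analysis] using h

/-- Already `S* S` is onto. From `⟨S* S c, c⟩ = ‖S c‖² ≥ A ‖c‖²` it is bounded below, so its range
is closed; a vector `d` orthogonal to the range has `‖S d‖² = 0`, hence `d = 0`. -/
theorem adjoint_surjective (hs : IsRieszSequence s a b) :
    Function.Surjective (ContinuousLinearMap.adjoint hs.synthesisCLM) := by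
  set S := hs.synthesisCLM with hS
  set T : ell2 →L[ℂ] ell2 := (ContinuousLinearMap.adjoint S).comp S with hT
  obtain ⟨A, hA, hb⟩ := hs.exists_bound_below
  have hTb : ∀ c, A * ‖c‖ ≤ ‖T c‖ := by
    intro c
    rcases (norm_nonneg c).eq_or_lt with h0 | h0
    · rw [← h0, mul_zero]; exact norm_nonneg _
    · refine le_of_mul_le_mul_right ?_ h0
      calc A * ‖c‖ * ‖c‖ = A * ‖c‖ ^ 2 := by ring
        _ ≤ ‖S c‖ ^ 2 := hb c
        _ = ‖(inner ℂ (T c) c : ℂ)‖ := by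
            rw [hT, ContinuousLinearMap.comp_apply, ContinuousLinearMap.adjoint_inner_left,
              inner_self_eq_norm_sq_to_K]
            simp
        _ ≤ ‖T c‖ * ‖c‖ := norm_inner_le_norm _ _
  have hanti : AntilipschitzWith (A⁻¹).toNNReal T :=
    ContinuousLinearMap.antilipschitz_of_bound _ fun c => by
      rw [Real.coe_toNNReal _ (by positivity), ← div_eq_inv_mul, le_div_iff₀ hA, mul_comm]
      exact hTb c
  have hclosed : IsClosed (Set.range T) := hanti.isClosed_range T.uniformContinuous
  have htop : LinearMap.range (T : ell2 →ₗ[ℂ] ell2) = ⊤ := by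
    have hc : IsClosed ((LinearMap.range (T : ell2 →ₗ[ℂ] ell2) : Submodule ℂ ell2) : Set ell2) :=
      hclosed
    have := hc.completeSpace_coe
    rw [← Submodule.orthogonal_eq_bot_iff, Submodule.eq_bot_iff]
    intro d hd
    have h0 : inner ℂ (T d) d = 0 := hd _ ⟨d, rfl⟩
    have h1 : ‖S d‖ ^ 2 = 0 := by
      rw [hT, ContinuousLinearMap.comp_apply, ContinuousLinearMap.adjoint_inner_left,
        inner_self_eq_norm_sq_to_K] at h0
      simpa using h0
    have h2 : ‖d‖ ^ 2 ≤ 0 := by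
      have := hb d
      rw [← hS, h1] at this
      nlinarith [sq_nonneg ‖d‖]
    exact norm_eq_zero.1 (pow_eq_zero_iff two_ne_zero |>.1 (le_antisymm h2 (sq_nonneg _)))
  intro d
  obtain ⟨c, hc⟩ := (LinearMap.range_eq_top.1 htop) d
  exact ⟨S c, hc⟩

end IsRieszSequence

/-- The operator `S* V` on square summable sequences. -/
def crossOp (hs : IsRieszSequence s a b) (hv : IsRieszSequence v a b) : ell2 →L[ℂ] ell2 :=
  (ContinuousLinearMap.adjoint hs.synthesisCLM).comp hv.synthesisCLM

/-- The closed spans give an oblique decomposition if and only if `S* V` is bijective. -/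
theorem isCompl_iff_bijective_crossOp (hs : IsRieszSequence s a b) (hv : IsRieszSequence v a b) :
    IsCompl (gaborSpace s a b)ᗮ (gaborSpace v a b) ↔ Function.Bijective (crossOp hs hv) := by
  constructor
  · intro h
    constructor
    · refine (injective_iff_map_eq_zero _).2 fun c hc => ?_
      have h1 : hv.synthesisCLM c ∈ (gaborSpace s a b)ᗮ :=
        (hs.mem_gaborSpace_orthogonal _).2 hc
      have h2 : hv.synthesisCLM c ∈ gaborSpace v a b := by
        rw [hv.gaborSpace_eq_range]; exact ⟨c, rfl⟩
      exact hv.injective ((Submodule.disjoint_def.1 h.disjoint _ h1 h2).trans (map_zero _).symm)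
    · intro d
      obtain ⟨f, rfl⟩ := hs.adjoint_surjective d
      obtain ⟨g, hg, w, hw, rfl⟩ := Submodule.mem_sup.1
        (show f ∈ (gaborSpace s a b)ᗮ ⊔ gaborSpace v a b from h.sup_eq_top ▸ Submodule.mem_top)
      rw [hv.gaborSpace_eq_range] at hw
      obtain ⟨c, rfl⟩ := hw
      refine ⟨c, ?_⟩
      rw [map_add, (hs.mem_gaborSpace_orthogonal g).1 hg, zero_add]
      rfl
  · intro h
    refine IsCompl.of_eq ?_ ?_
    · rw [Submodule.eq_bot_iff]
      rintro f ⟨h1, h2⟩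
      rw [hv.gaborSpace_eq_range] at h2
      obtain ⟨c, rfl⟩ := h2
      have h3 : crossOp hs hv c = 0 := (hs.mem_gaborSpace_orthogonal _).1 h1
      have h4 : c = 0 := h.1 (h3.trans (map_zero _).symm)
      rw [h4, map_zero]
    · rw [Submodule.eq_top_iff']
      intro f
      obtain ⟨c, hc⟩ := h.2 (ContinuousLinearMap.adjoint hs.synthesisCLM f)
      refine Submodule.mem_sup.2 ⟨f - hv.synthesisCLM c, ?_, hv.synthesisCLM c, ?_,
        sub_add_cancel _ _⟩
      · rw [hs.mem_gaborSpace_orthogonal, map_sub, ← hc]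
        exact sub_self _
      · rw [hv.gaborSpace_eq_range]; exact ⟨c, rfl⟩

theorem inner_gaborSystem (s v : L2) (a b : ℝ) (k j : ℤ × ℤ) :
    inner ℂ (gaborSystem s a b k) (gaborSystem v a b j) = crossCorr s v a b (k - j) *
      Complex.exp (-2 * π * Complex.I * ((a * b : ℝ) : ℂ) * j.1 * (k.2 - j.2)) := by
  rw [gaborSystem, gaborSystem, inner_tfShift_tfShift, mul_comm, crossCorr, gaborSystem]
  congr 2
  · congr 2
    · push_cast [Prod.fst_sub]; ring
    · push_cast [Prod.snd_sub]; ring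
  · push_cast; ring

/-- The operator `S* V` is twisted convolution by the cross-correlation sequence. -/
theorem analysis_synthesis (hv : IsRieszSequence v a b) (c : ell2) :
    analysis s a b (synthesis v a b c) = twistedConv (a * b) (crossCorr s v a b) c := by
  funext k
  have h := (hv.hasSum c).mapL (innerSL ℂ (gaborSystem s a b k))
  have h1 : analysis s a b (synthesis v a b c) k =
      ∑' j, c j * inner ℂ (gaborSystem s a b k) (gaborSystem v a b j) := by
    simpa [inner_smul_right, analysis] using h.tsum_eq.symm
  rw [h1, twistedConv, ← (Equiv.subLeft k).tsum_eq]
  refine tsum_congr fun m => ?_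
  rw [inner_gaborSystem, Equiv.subLeft_apply, sub_sub_cancel]
  have : (-2 * π * Complex.I * ((a * b : ℝ) : ℂ) * ((k - m).1 : ℤ) * (k.2 - ((k - m).2 : ℤ)) : ℂ)
      = -2 * π * Complex.I * ((a * b : ℝ) : ℂ) * (k.1 - m.1) * m.2 := by
    push_cast [Prod.fst_sub, Prod.snd_sub]; ring
  rw [this]
  ring

/-- These matrix entries are all that the passage to the symbol needs to know about `S* V`. -/
theorem crossOp_single_apply (hs : IsRieszSequence s a b) (hv : IsRieszSequence v a b)
    (j k : ℤ × ℤ) : (crossOp hs hv (lp.single 2 j 1) : ell2) k =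
      crossCorr s v a b (k - j) *
        Complex.exp (-2 * π * Complex.I * ((a * b : ℝ) : ℂ) * j.1 * (k.2 - j.2)) := by
  rw [crossOp, ContinuousLinearMap.comp_apply, hv.synthesisCLM_single, hs.adjoint_apply,
    analysis, inner_gaborSystem]

end Gabor

/-! ### Multiplication by continuous matrix functions on `L²` -/

namespace Gabor

section EvalMatrix

variable {X : Type*} [TopologicalSpace X] {ι : Type*}

/-- Pointwise evaluation of a matrix of continuous functions. -/
def evalMatrix (φ : Matrix ι ι C(X, ℂ)) (x : X) : Matrix ι ι ℂ := Matrix.of fun i j => φ i j x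

theorem det_apply [Fintype ι] [DecidableEq ι] (φ : Matrix ι ι C(X, ℂ)) (x : X) :
    φ.det x = (evalMatrix φ x).det := by
  simp [Matrix.det_apply, evalMatrix, ContinuousMap.sum_apply]

end EvalMatrix

section Multiplication

variable {X : Type*} [TopologicalSpace X] [CompactSpace X] [MeasurableSpace X] [BorelSpace X] (μ : Measure X) [IsFiniteMeasure μ]

/-- Multiplication by a continuous function, as a bounded operator on `L²`. -/
def mulOp : C(X, ℂ) →L[ℂ] (Lp ℂ 2 μ →L[ℂ] Lp ℂ 2 μ) :=
  ((ContinuousLinearMap.mul ℂ ℂ).holderL μ ∞ 2 2).comp (ContinuousMap.toLp ∞ μ ℂ)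

theorem coeFn_mulOp (φ : C(X, ℂ)) (f : Lp ℂ 2 μ) :
    mulOp μ φ f =ᵐ[μ] fun x => φ x * f x := by
  have h := (ContinuousLinearMap.mul ℂ ℂ).coeFn_holder (r := 2) (ContinuousMap.toLp ∞ μ ℂ φ) f
  filter_upwards [h, ContinuousMap.coeFn_toLp (p := ∞) (𝕜 := ℂ) μ φ] with x h1 h2
  rw [← h2]
  exact h1

theorem mulOp_mul (φ ψ : C(X, ℂ)) (f : Lp ℂ 2 μ) :
    mulOp μ (φ * ψ) f = mulOp μ φ (mulOp μ ψ f) := by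
  apply Lp.ext
  filter_upwards [coeFn_mulOp μ (φ * ψ) f, coeFn_mulOp μ φ (mulOp μ ψ f), coeFn_mulOp μ ψ f]
    with x h1 h2 h3
  rw [h1, h2, h3, ContinuousMap.mul_apply, mul_assoc]

theorem mulOp_one (f : Lp ℂ 2 μ) : mulOp μ 1 f = f := by
  apply Lp.ext
  filter_upwards [coeFn_mulOp μ 1 f] with x h1
  rw [h1, ContinuousMap.one_apply, one_mul]

theorem mulOp_toLp (φ ψ : C(X, ℂ)) :
    mulOp μ φ (ContinuousMap.toLp 2 μ ℂ ψ) = ContinuousMap.toLp 2 μ ℂ (φ * ψ) := by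
  apply Lp.ext
  filter_upwards [coeFn_mulOp μ φ (ContinuousMap.toLp 2 μ ℂ ψ),
    ContinuousMap.coeFn_toLp (p := 2) (𝕜 := ℂ) μ ψ,
    ContinuousMap.coeFn_toLp (p := 2) (𝕜 := ℂ) μ (φ * ψ)] with x h1 h2 h3
  rw [h1, h2, h3, ContinuousMap.mul_apply]

theorem norm_mulOp_indicator_le {U : Set X} (hU : MeasurableSet U) (φ : C(X, ℂ)) {ε : ℝ}
    (hε : ∀ x ∈ U, ‖φ x‖ ≤ ε) :
    ‖mulOp μ φ (indicatorConstLp 2 hU (measure_ne_top μ U) 1)‖ ≤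
      ε * ‖indicatorConstLp 2 hU (measure_ne_top μ U) (1 : ℂ)‖ := by
  refine Lp.norm_le_mul_norm_of_ae_le_mul ?_
  filter_upwards [coeFn_mulOp μ φ (indicatorConstLp 2 hU (measure_ne_top μ U) 1),
    indicatorConstLp_coeFn (p := 2) (hs := hU) (hμs := measure_ne_top μ U) (c := (1 : ℂ))]
    with x h1 h2
  rw [h1, h2, norm_mul]
  by_cases hx : x ∈ U
  · exact mul_le_mul_of_nonneg_right (hε x hx) (norm_nonneg _)
  · simp [hx]

variable {ι : Type*} [Fintype ι]

/-- Multiplication by a matrix of continuous functions on vectors of `L²` functions. -/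
def blockOp (φ : Matrix ι ι C(X, ℂ)) : (ι → Lp ℂ 2 μ) →L[ℂ] (ι → Lp ℂ 2 μ) :=
  ContinuousLinearMap.pi fun i => ∑ j, (mulOp μ (φ i j)).comp (ContinuousLinearMap.proj j)

theorem blockOp_apply (φ : Matrix ι ι C(X, ℂ)) (f : ι → Lp ℂ 2 μ) (i : ι) :
    blockOp μ φ f i = ∑ j, mulOp μ (φ i j) (f j) := by
  simp [blockOp]

theorem blockOp_mul (φ ψ : Matrix ι ι C(X, ℂ)) (f : ι → Lp ℂ 2 μ) :
    blockOp μ (φ * ψ) f = blockOp μ φ (blockOp μ ψ f) := by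
  funext i
  simp only [blockOp_apply, Matrix.mul_apply, map_sum, _root_.sum_apply, mulOp_mul]
  exact Finset.sum_comm

variable [DecidableEq ι]

theorem blockOp_one (f : ι → Lp ℂ 2 μ) : blockOp μ (1 : Matrix ι ι C(X, ℂ)) f = f := by
  funext i
  rw [blockOp_apply, Finset.sum_eq_single i]
  · rw [Matrix.one_apply_eq, mulOp_one]
  · intro j _ hj
    rw [Matrix.one_apply_ne' hj, map_zero, _root_.zero_apply]
  · exact fun h => absurd (Finset.mem_univ i) h

/-- A nowhere vanishing determinant is a unit of `C(X, ℂ)`, so the matrix is invertible over that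
ring and its inverse acts as the inverse operator. -/
theorem bijective_blockOp_of_det_ne_zero (φ : Matrix ι ι C(X, ℂ))
    (h : ∀ x, (evalMatrix φ x).det ≠ 0) : Function.Bijective (blockOp μ φ) := by
  have h1 : IsUnit φ.det :=
    ContinuousMap.isUnit_iff_forall_ne_zero _ |>.2 fun x => by rw [det_apply]; exact h x
  refine Function.bijective_iff_has_inverse.2 ⟨blockOp μ φ⁻¹, fun f => ?_, fun f => ?_⟩
  · rw [← blockOp_mul, Matrix.nonsing_inv_mul _ h1, blockOp_one]
  · rw [← blockOp_mul, Matrix.mul_nonsing_inv _ h1, blockOp_one]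

/-- If `φ(x) w = 0` with `w ≠ 0`, then `φ w` is small near `x`, so `w` times the indicator of a
neighbourhood is nearly annihilated, against the bounded inverse. Open sets must have positive
measure for this test vector to be nonzero. -/
theorem det_ne_zero_of_bijective_blockOp [μ.IsOpenPosMeasure] (φ : Matrix ι ι C(X, ℂ))
    (h : Function.Bijective (blockOp μ φ)) (x : X) : (evalMatrix φ x).det ≠ 0 := by
  intro h0
  obtain ⟨w, hw, hw0⟩ := Matrix.exists_mulVec_eq_zero_iff.2 h0
  obtain ⟨K, hK⟩ : ∃ K : ℝ, ∀ f, ‖f‖ ≤ K * ‖blockOp μ φ f‖ := by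
    let e := ContinuousLinearEquiv.ofBijective (blockOp μ φ)
      (LinearMap.ker_eq_bot.2 h.1) (LinearMap.range_eq_top.2 h.2)
    refine ⟨‖(e.symm : (ι → Lp ℂ 2 μ) →L[ℂ] (ι → Lp ℂ 2 μ))‖, fun f => ?_⟩
    have h1 := (e.symm : (ι → Lp ℂ 2 μ) →L[ℂ] (ι → Lp ℂ 2 μ)).le_opNorm (e f)
    simpa [e] using h1
  have hwpos : 0 < ‖w‖ := norm_pos_iff.2 hw
  -- Chosen so that `|K| ε < ‖w‖`, contradicting `h6` below.
  set ε : ℝ := ‖w‖ / (2 * (|K| + 1)) with hε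
  have hεpos : 0 < ε := by positivity
  let ψ : ι → C(X, ℂ) := fun i => ∑ j, w j • φ i j
  have hψ : ∀ i, ψ i x = 0 := fun i => by
    have := congrFun hw0 i
    simp only [Matrix.mulVec, dotProduct, evalMatrix, Matrix.of_apply, Pi.zero_apply] at this
    simp only [ψ, ContinuousMap.sum_apply, ContinuousMap.smul_apply, smul_eq_mul]
    rw [← this]
    exact Finset.sum_congr rfl fun j _ => mul_comm _ _
  let U : Set X := {y | ∀ i, ‖ψ i y‖ < ε}
  have hUo : IsOpen U := by
    have : U = ⋂ i, {y | ‖ψ i y‖ < ε} := by ext y; simp [U]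
    rw [this]
    exact isOpen_iInter_of_finite fun i => isOpen_lt (ψ i).continuous.norm continuous_const
  have hxU : x ∈ U := fun i => by rw [hψ, norm_zero]; exact hεpos
  have hUm : MeasurableSet U := hUo.measurableSet
  set χ : Lp ℂ 2 μ := indicatorConstLp 2 hUm (measure_ne_top μ U) (1 : ℂ) with hχ
  have hχpos : 0 < ‖χ‖ := by
    rw [hχ, norm_indicatorConstLp (by norm_num) (by norm_num), norm_one, one_mul]
    have : 0 < μ.real U :=
      ENNReal.toReal_pos (hUo.measure_pos μ ⟨x, hxU⟩).ne' (measure_ne_top μ U)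
    exact Real.rpow_pos_of_pos this _
  have h2 : ‖blockOp μ φ (fun i => w i • χ)‖ ≤ ε * ‖χ‖ := by
    refine (pi_norm_le_iff_of_nonneg (by positivity)).2 fun i => ?_
    have h3 : blockOp μ φ (fun i => w i • χ) i = mulOp μ (ψ i) χ := by
      simp [blockOp_apply, ψ]
    rw [h3]
    exact norm_mulOp_indicator_le μ hUm (ψ i) fun y hy => (hy i).le
  have h4 : ‖w‖ * ‖χ‖ ≤ ‖(fun i => w i • χ : ι → Lp ℂ 2 μ)‖ := by
    rw [← le_div_iff₀ hχpos]
    refine (pi_norm_le_iff_of_nonneg (by positivity)).2 fun i => ?_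
    rw [le_div_iff₀ hχpos, ← norm_smul]
    exact norm_le_pi_norm (fun i => w i • χ) i
  have h5 : ‖w‖ * ‖χ‖ ≤ |K| * (ε * ‖χ‖) :=
    h4.trans ((hK _).trans ((mul_le_mul_of_nonneg_right (le_abs_self K) (norm_nonneg _)).trans
      (mul_le_mul_of_nonneg_left h2 (abs_nonneg K))))
  have h6 : ‖w‖ ≤ |K| * ε := by
    rw [← mul_assoc] at h5
    exact le_of_mul_le_mul_right h5 hχpos
  have h7 : 2 * (|K| + 1) * ε = ‖w‖ := by rw [hε]; field_simp
  nlinarith [abs_nonneg K]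

end Multiplication

end Gabor

/-! ### Fourier series on the torus and the symbol of `S* V` -/

namespace Gabor

open UnitAddTorus

local instance : MeasureSpace UnitAddCircle := ⟨AddCircle.haarAddCircle⟩

local instance : Measure.IsAddHaarMeasure (volume : Measure UnitAddCircle) :=
  inferInstanceAs (Measure.IsAddHaarMeasure AddCircle.haarAddCircle)

local instance : IsProbabilityMeasure (volume : Measure UnitAddCircle) :=
  inferInstanceAs (IsProbabilityMeasure AddCircle.haarAddCircle)

/-- The normalised Haar measure on the two-dimensional torus. -/
def torusMeasure : Measure (UnitAddTorus (Fin 2)) := volume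

instance : IsFiniteMeasure torusMeasure :=
  inferInstanceAs (IsFiniteMeasure (volume : Measure (UnitAddTorus (Fin 2))))

instance : torusMeasure.IsOpenPosMeasure :=
  inferInstanceAs (volume : Measure (UnitAddTorus (Fin 2))).IsOpenPosMeasure

/-- The Hilbert space of square integrable functions on the two-dimensional torus. -/
abbrev L2Torus : Type := Lp ℂ 2 torusMeasure

/-- The Fourier basis of `L²` of the two-dimensional torus. -/
def fourierBasis : HilbertBasis (Fin 2 → ℤ) ℂ L2Torus := mFourierBasis

theorem fourierBasis_apply (n : Fin 2 → ℤ) :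
    fourierBasis n = ContinuousMap.toLp 2 torusMeasure ℂ (mFourier n) :=
  congrFun coe_mFourierBasis n

theorem mulOp_fourierBasis (m n : Fin 2 → ℤ) :
    mulOp torusMeasure (mFourier m) (fourierBasis n) = fourierBasis (m + n) := by
  rw [fourierBasis_apply, fourierBasis_apply, mulOp_toLp]
  congr 1
  ext x
  exact mFourier_add.symm

theorem inner_fourierBasis (m n : Fin 2 → ℤ) :
    inner ℂ (fourierBasis m) (fourierBasis n) = if m = n then 1 else 0 :=
  orthonormal_iff_ite.1 fourierBasis.orthonormal m n

theorem fourierBasis_ext {f g : L2Torus}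
    (h : ∀ n, inner ℂ (fourierBasis n) f = inner ℂ (fourierBasis n) g) : f = g := by
  refine fourierBasis.repr.injective (lp.ext (funext fun n => ?_))
  rw [HilbertBasis.repr_apply_apply, HilbertBasis.repr_apply_apply, h]

variable (p : ℕ)

/-- Each exponent changes by an integer multiple of `2πi`; this periodicity lets one period cell
decide invertibility everywhere. -/
theorem Phi_add_int_mul {a b : ℝ} (ha : a ≠ 0) (hb : b ≠ 0) (h : ℤ × ℤ → ℂ) (ω x : ℝ) (m n : ℤ) :
    Phi p a b h (ω + m * (1 / a)) (x + n * (1 / b)) = Phi p a b h ω x := by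
  ext i j
  simp only [Phi, Matrix.of_apply]
  refine tsum_congr fun k => ?_
  have ha' : (a : ℂ) ≠ 0 := Complex.ofReal_ne_zero.2 ha
  have hb' : (b : ℂ) ≠ 0 := Complex.ofReal_ne_zero.2 hb
  have h1 : (-2 * π * Complex.I * (b * k.2 * ((x + n * (1 / b) : ℝ) : ℂ) +
      a * k.1 * ((ω + m * (1 / a) : ℝ) : ℂ)) : ℂ) =
      -2 * π * Complex.I * (b * k.2 * x + a * k.1 * ω) +
        ((-(k.2 * n + k.1 * m) : ℤ) : ℂ) * (2 * π * Complex.I) := by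
    push_cast
    field_simp
    ring
  rw [h1, Complex.exp_add, Complex.exp_int_mul_two_pi_mul_I, mul_one]

theorem isUnit_Phi_iff {a b : ℝ} (ha : 0 < a) (hb : 0 < b) (h : ℤ × ℤ → ℂ) :
    (∀ ω ∈ Set.Ico (0 : ℝ) (1 / a), ∀ x ∈ Set.Ico (0 : ℝ) (1 / b), IsUnit (Phi p a b h ω x)) ↔
      ∀ ω x : ℝ, (Phi p a b h ω x).det ≠ 0 := by
  simp only [Matrix.isUnit_iff_isUnit_det, isUnit_iff_ne_zero]
  refine ⟨fun H ω x => ?_, fun H ω _ x _ => H ω x⟩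
  have ha' : (0 : ℝ) < 1 / a := by positivity
  have hb' : (0 : ℝ) < 1 / b := by positivity
  have h1 := H (toIcoMod ha' 0 ω) (by simpa using toIcoMod_mem_Ico ha' 0 ω)
    (toIcoMod hb' 0 x) (by simpa using toIcoMod_mem_Ico hb' 0 x)
  have e1 : toIcoMod ha' 0 ω + toIcoDiv ha' 0 ω * (1 / a) = ω := by
    rw [← zsmul_eq_mul]; exact toIcoMod_add_toIcoDiv_zsmul _ _ _
  have e2 : toIcoMod hb' 0 x + toIcoDiv hb' 0 x * (1 / b) = x := by
    rw [← zsmul_eq_mul]; exact toIcoMod_add_toIcoDiv_zsmul _ _ _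
  rwa [← Phi_add_int_mul p ha.ne' hb.ne' h _ _ (toIcoDiv ha' 0 ω) (toIcoDiv hb' 0 x), e1, e2] at h1

/-- The orthonormal family of vectors with one nonzero entry, an exponential. -/
def blockVector (y : Fin p × (Fin 2 → ℤ)) : PiLp 2 (fun _ : Fin p => L2Torus) :=
  WithLp.toLp 2 (Pi.single y.1 (fourierBasis y.2))

theorem inner_blockVector (y : Fin p × (Fin 2 → ℤ)) (f : PiLp 2 (fun _ : Fin p => L2Torus)) :
    inner ℂ (blockVector p y) f = inner ℂ (fourierBasis y.2) (f y.1) := by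
  rw [PiLp.inner_apply, Finset.sum_eq_single y.1]
  · simp [blockVector]
  · intro i _ hi
    simp [blockVector, hi]
  · exact fun h => absurd (Finset.mem_univ _) h

variable [NeZero p]

/-- Splitting a double index into the residue class of its first component modulo `p` and the
index within this class. -/
def blockIndex : ℤ × ℤ ≃ Fin p × (Fin 2 → ℤ) where
  toFun k := ((Int.divModEquiv p k.1).2, ![(Int.divModEquiv p k.1).1, k.2])
  invFun y := ((Int.divModEquiv p).symm (y.2 0, y.1), y.2 1)
  left_inv k := Prod.ext ((Int.divModEquiv p).symm_apply_apply k.1) rfl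
  right_inv y := by
    have h := (Int.divModEquiv p).apply_symm_apply (y.2 0, y.1)
    refine Prod.ext (congrArg Prod.snd h) (funext fun i => ?_)
    fin_cases i
    · exact congrArg Prod.fst h
    · rfl

theorem blockIndex_symm_apply (i : Fin p) (n : Fin 2 → ℤ) :
    (blockIndex p).symm (i, n) = (n 0 * p + (i : ℕ), n 1) := rfl

theorem orthonormal_blockVector :
    Orthonormal ℂ fun k : ℤ × ℤ => blockVector p (blockIndex p k) := by
  suffices h : Orthonormal ℂ (blockVector p) from h.comp _ (blockIndex p).injective
  rw [orthonormal_iff_ite]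
  rintro ⟨i, m⟩ ⟨j, n⟩
  rw [inner_blockVector]
  by_cases hij : i = j
  · subst hij
    simp [blockVector, inner_fourierBasis]
  · simp [blockVector, hij]

/-- The Hilbert basis of vectors of functions on the torus indexed by double indices. -/
def blockBasis : HilbertBasis (ℤ × ℤ) ℂ (PiLp 2 (fun _ : Fin p => L2Torus)) :=
  HilbertBasis.mkOfOrthogonalEqBot (orthonormal_blockVector p) <| by
    rw [Submodule.eq_bot_iff]
    intro f hf
    have h : ∀ y, inner ℂ (blockVector p y) f = 0 := fun y => by
      obtain ⟨k, rfl⟩ := (blockIndex p).surjective y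
      exact hf _ (Submodule.subset_span ⟨k, rfl⟩)
    ext1 i
    refine fourierBasis.repr.injective (lp.ext (funext fun n => ?_))
    have h1 := h (i, n)
    rw [inner_blockVector] at h1
    rw [HilbertBasis.repr_apply_apply, h1, PiLp.zero_apply, map_zero]
    rfl

/-- Square summable sequences as vectors of functions on the torus. -/
def blockEquiv : ell2 ≃L[ℂ] (Fin p → L2Torus) :=
  (blockBasis p).repr.symm.toContinuousLinearEquiv.trans
    -- Passing to the sup norm on tuples loses the isometry, but bijectivity of operators is
    -- unaffected.
    (PiLp.continuousLinearEquiv 2 ℂ fun _ : Fin p => L2Torus)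

theorem blockEquiv_single (j : Fin p) (n : Fin 2 → ℤ) :
    blockEquiv p (lp.single 2 ((blockIndex p).symm (j, n)) 1) = Pi.single j (fourierBasis n) := by
  have h := (blockBasis p).repr_symm_single ((blockIndex p).symm (j, n))
  rw [blockBasis, HilbertBasis.coe_mkOfOrthogonalEqBot, Equiv.apply_symm_apply] at h
  exact congrArg (PiLp.continuousLinearEquiv 2 ℂ fun _ : Fin p => L2Torus) h

theorem inner_blockEquiv (c : ell2) (i : Fin p) (n : Fin 2 → ℤ) :
    inner ℂ (fourierBasis n) (blockEquiv p c i) = c ((blockIndex p).symm (i, n)) := by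
  have h := (blockBasis p).repr_apply_apply ((blockBasis p).repr.symm c)
    ((blockIndex p).symm (i, n))
  rw [LinearIsometryEquiv.apply_symm_apply, blockBasis, HilbertBasis.coe_mkOfOrthogonalEqBot,
    Equiv.apply_symm_apply, inner_blockVector] at h
  exact h.symm

/-- The Fourier coefficients of the entries of the symbol of a twisted convolution. -/
def symbolCoeff (θ : ℝ) (r : ℤ × ℤ → ℂ) (i j : Fin p) (κ : Fin 2 → ℤ) : ℂ :=
  r ((i : ℤ) - (j : ℤ) + p * κ 0, κ 1) * Complex.exp (-2 * π * Complex.I * θ * κ 1 * (j : ℕ))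

/-- The matrix-valued symbol of a twisted convolution. -/
def symbol (θ : ℝ) (r : ℤ × ℤ → ℂ) : Matrix (Fin p) (Fin p) C(UnitAddTorus (Fin 2), ℂ) :=
  Matrix.of fun i j => ∑' κ : Fin 2 → ℤ, symbolCoeff p θ r i j κ • mFourier κ

variable {θ : ℝ} {r : ℤ × ℤ → ℂ}

theorem summable_symbol (hr : Summable r) (i j : Fin p) :
    Summable fun κ : Fin 2 → ℤ => symbolCoeff p θ r i j κ • mFourier (d := Fin 2) κ := by
  have hinj : Function.Injective fun κ : Fin 2 → ℤ =>
      (((i : ℤ) - (j : ℤ) + p * κ 0, κ 1) : ℤ × ℤ) := by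
    intro κ κ' h
    simp only [Prod.mk.injEq, add_right_inj, mul_eq_mul_left_iff, Nat.cast_eq_zero,
      NeZero.ne p, or_false] at h
    ext i
    fin_cases i
    · exact h.1
    · exact h.2
  refine Summable.of_norm ((hr.norm.comp_injective hinj).congr fun κ => ?_)
  rw [norm_smul, mFourier_norm, mul_one, symbolCoeff, norm_mul,
    norm_exp_mul_I_real (-2 * π * θ * κ 1 * (j : ℕ)) _ (by push_cast; ring), mul_one]
  rfl

/-- The symbol converges in the sup norm, so bounded maps apply termwise; `mFourier κ` sends basis
vector `n` to `κ + n`, and only `κ = m - n` survives. -/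
theorem inner_mulOp_symbol (hr : Summable r) (i j : Fin p) (m n : Fin 2 → ℤ) :
    inner ℂ (fourierBasis m) (mulOp torusMeasure (symbol p θ r i j) (fourierBasis n)) =
      symbolCoeff p θ r i j (m - n) := by
  have h1 := (summable_symbol p (θ := θ) hr i j).hasSum
  have h2 := ((h1.mapL (mulOp torusMeasure)).mapL
    (ContinuousLinearMap.apply ℂ L2Torus (fourierBasis n))).mapL (innerSL ℂ (fourierBasis m))
  refine h2.unique ?_
  convert! hasSum_ite_eq (m - n) (symbolCoeff p θ r i j (m - n)) using 2 with κ
  simp only [map_smul, ContinuousLinearMap.apply_apply, mulOp_fourierBasis, innerSL_apply_apply,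
    inner_fourierBasis, smul_eq_mul, mul_ite, mul_one, mul_zero]
  by_cases hκ : κ = m - n
  · subst hκ; simp
  · rw [if_neg hκ, if_neg fun h => hκ (by rw [h, add_sub_cancel_right])]

/-- A bounded operator acting on unit vectors by twisted translates of an absolutely summable
sequence is, on the Fourier side, multiplication by the symbol. -/
theorem blockEquiv_comp (hr : Summable r) {q : ℤ} (hθ : θ * p = q) (T : ell2 →L[ℂ] ell2)
    (hT : ∀ j k : ℤ × ℤ, (T (lp.single 2 j 1) : ell2) k =
      r (k - j) * Complex.exp (-2 * π * Complex.I * θ * j.1 * (k.2 - j.2))) (c : ell2) :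
    blockEquiv p (T c) = blockOp torusMeasure (symbol p θ r) (blockEquiv p c) := by
  have key : ((blockEquiv p : ell2 →L[ℂ] (Fin p → L2Torus)).comp T) =
      (blockOp torusMeasure (symbol p θ r)).comp (blockEquiv p : ell2 →L[ℂ] (Fin p → L2Torus)) := by
    -- Bounded operators on `ℓ²` agree once they agree on unit vectors; these are then compared by
    -- Fourier coefficients.
    refine lp.ext_continuousLinearMap ENNReal.ofNat_ne_top fun k => ?_
    ext1
    obtain ⟨⟨j, n⟩, rfl⟩ := (blockIndex p).symm.surjective k
    change blockEquiv p (T (lp.single 2 _ 1)) =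
      blockOp torusMeasure (symbol p θ r) (blockEquiv p (lp.single 2 _ 1))
    funext i
    refine fourierBasis_ext fun m => ?_
    rw [inner_blockEquiv, hT, blockEquiv_single, blockOp_apply, Finset.sum_eq_single j,
      Pi.single_eq_same, inner_mulOp_symbol p hr, symbolCoeff]
    · simp only [blockIndex_symm_apply]
      congr 1
      · congr 1
        ext
        · simp only [Prod.fst_sub, Pi.sub_apply]; ring_nf
        · simp
      -- Rationality enters here: with `θ p = q` the quotient part of the first index contributes
      -- only a full period to the phase.
      · have hθ' : (θ : ℂ) * p = q := by exact_mod_cast hθ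
        have h1 : (-2 * π * Complex.I * θ * ((n 0 * p + (j : ℕ) : ℤ) : ℂ) * (m 1 - n 1) : ℂ) =
            -2 * π * Complex.I * θ * ((m - n) 1 : ℤ) * (j : ℕ) +
              ((-(q * n 0 * (m 1 - n 1)) : ℤ) : ℂ) * (2 * π * Complex.I) := by
          push_cast [Pi.sub_apply]
          rw [← hθ']
          ring
        rw [h1, Complex.exp_add, Complex.exp_int_mul_two_pi_mul_I, mul_one]
    · intro j' _ hj'
      rw [Pi.single_eq_of_ne hj', map_zero]
    · exact fun h => absurd (Finset.mem_univ _) h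
  exact congrArg (fun L : ell2 →L[ℂ] (Fin p → L2Torus) => L c) key

theorem bijective_iff_det_symbol_ne_zero (hr : Summable r) {q : ℤ} (hθ : θ * p = q)
    (T : ell2 →L[ℂ] ell2)
    (hT : ∀ j k : ℤ × ℤ, (T (lp.single 2 j 1) : ell2) k =
      r (k - j) * Complex.exp (-2 * π * Complex.I * θ * j.1 * (k.2 - j.2))) :
    Function.Bijective T ↔ ∀ x, (evalMatrix (symbol p θ r) x).det ≠ 0 := by
  have h : blockEquiv p ∘ T = blockOp torusMeasure (symbol p θ r) ∘ blockEquiv p :=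
    funext fun c => blockEquiv_comp p hr hθ T hT c
  have h1 : Function.Bijective T ↔ Function.Bijective (blockOp torusMeasure (symbol p θ r)) := by
    rw [← (blockEquiv p).bijective.of_comp_iff' T, h,
      Function.Bijective.of_comp_iff _ (blockEquiv p).bijective]
  rw [h1]
  exact ⟨fun hb x => det_ne_zero_of_bijective_blockOp torusMeasure _ hb x,
    fun hd => bijective_blockOp_of_det_ne_zero torusMeasure _ hd⟩

/-- Columns of the symbol index the input residue, which `Phi` places in the row index, hence the
transpose; the signs turn the characters `exp (2πi ·)` into those of `Phi`. -/
theorem evalMatrix_symbol (hr : Summable r) {a b : ℝ} (hθ : a * b = θ) (ω x : ℝ) :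
    evalMatrix (symbol p θ r) ![((-(a * ω) : ℝ) : UnitAddCircle), ((-(b * x) : ℝ) : UnitAddCircle)]
      = (Phi p a b r ω x).transpose := by
  ext i j
  rw [Matrix.transpose_apply, Phi, Matrix.of_apply, evalMatrix, Matrix.of_apply, symbol,
    Matrix.of_apply, ← ContinuousMap.tsum_apply (summable_symbol p hr i j),
    ← (finTwoArrowEquiv ℤ).tsum_eq]
  refine tsum_congr fun κ => ?_
  have h0 : ((finTwoArrowEquiv ℤ) κ) = (κ 0, κ 1) := rfl
  rw [h0, ContinuousMap.smul_apply, symbolCoeff, smul_eq_mul, mFourier, ContinuousMap.coe_mk,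
    Fin.prod_univ_two]
  simp only [Matrix.cons_val_zero, Matrix.cons_val_one, fourier_coe_apply, ← Complex.exp_add]
  congr 2
  · rw [← hθ]; push_cast; ring_nf
  · push_cast; ring

theorem det_symbol_ne_zero_iff (hr : Summable r) {a b : ℝ} (ha : a ≠ 0) (hb : b ≠ 0)
    (hθ : a * b = θ) :
    (∀ x, (evalMatrix (symbol p θ r) x).det ≠ 0) ↔ ∀ ω x : ℝ, (Phi p a b r ω x).det ≠ 0 := by
  constructor
  · intro h ω x
    rw [← Matrix.det_transpose, ← evalMatrix_symbol p hr hθ]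
    exact h _
  · intro h z
    obtain ⟨t, ht⟩ := QuotientAddGroup.mk_surjective (z 0)
    obtain ⟨u, hu⟩ := QuotientAddGroup.mk_surjective (z 1)
    -- As `a, b ≠ 0`, every torus point has the form covered by `evalMatrix_symbol`.
    have hz : z = ![((-(a * (-t / a)) : ℝ) : UnitAddCircle),
        ((-(b * (-u / b)) : ℝ) : UnitAddCircle)] := by
      rw [mul_div_cancel₀ _ ha, mul_div_cancel₀ _ hb, neg_neg, neg_neg]
      ext i
      fin_cases i
      · exact ht.symm
      · exact hu.symm
    rw [hz, evalMatrix_symbol p hr hθ, Matrix.det_transpose]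
    exact h _ _

end Gabor

end

theorem proposition6p1 (a b : ℝ) (ha : 0 < a) (hb : 0 < b)
    (p q : ℕ) (hp : 0 < p) (hpq : Nat.Coprime p q) (hab : a * b = (q : ℝ) / (p : ℝ))
    (s v : Gabor.L2) (hs₀ : Gabor.MemFeichtinger s) (hv₀ : Gabor.MemFeichtinger v)
    (hs : Gabor.IsRieszSequence s a b) (hv : Gabor.IsRieszSequence v a b) :
    Summable (Gabor.crossCorr s v a b) ∧
    (∀ c : Gabor.ell2, Gabor.analysis s a b (Gabor.synthesis v a b c) =
      Gabor.twistedConv (a * b) (Gabor.crossCorr s v a b) c) ∧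
    (IsCompl (Gabor.gaborSpace s a b)ᗮ (Gabor.gaborSpace v a b) ↔
      ∀ ω ∈ Set.Ico (0 : ℝ) (1 / a), ∀ x ∈ Set.Ico (0 : ℝ) (1 / b),
        IsUnit (Gabor.Phi p a b (Gabor.crossCorr s v a b) ω x)) ∧
    ((∀ ω ∈ Set.Ico (0 : ℝ) (1 / a), ∀ x ∈ Set.Ico (0 : ℝ) (1 / b),
        IsUnit (Gabor.Phi p a b (Gabor.crossCorr s v a b) ω x)) ↔
      ∀ ω x : ℝ, (Gabor.Phi p a b (Gabor.crossCorr s v a b) ω x).det ≠ 0) := by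
  have : NeZero p := ⟨hp.ne'⟩
  have hr := Gabor.summable_crossCorr ha.ne' hb.ne' s v hs₀ hv₀
  have hθ : a * b * p = (q : ℤ) := by
    rw [hab, div_mul_cancel₀ _ (Nat.cast_ne_zero.2 hp.ne'), Int.cast_natCast]
  refine ⟨hr, Gabor.analysis_synthesis hv, ?_, Gabor.isUnit_Phi_iff p ha hb _⟩
  rw [Gabor.isCompl_iff_bijective_crossOp hs hv, Gabor.isUnit_Phi_iff p ha hb,
    Gabor.bijective_iff_det_symbol_ne_zero p hr hθ _ (Gabor.crossOp_single_apply hs hv),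
    Gabor.det_symbol_ne_zero_iff p hr ha.ne' hb.ne' rfl]
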